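/- Let $-1<q<1$ and $H=L^2(\mathbb{R}_+,dx)$ (complex). Let $\mathcal{F}_q(H)$ be the $q$-Fock space, that is, the completion of $\mathcal{F}_{\mathrm{alg}}(H)=\bigoplus_{n\ge 0}H^{\otimes n}$ (with vacuum vector $\Omega$ spanning $H^{\otimes 0}$) for the inner product $$\langle f_1\otimes\cdots\otimes f_k,\;g_1\otimes\cdots\otimes g_n\rangle_q=\delta_{kn}\sum_{\sigma\in \mathrm{Sym}(n)}q^{i(\sigma)}\prod_{j=1}^n\langle f_j,g_{\sigma(j)}\rangle ,$$ where $i(\sigma)$ is the number of inversions of $\sigma$. On $\mathcal{F}_{\mathrm{alg}}(H)$ let, for $f\in H$ and, in the definition of $p(f)$, $f$ bounded, $$a^*(f)(g_1\otimes\cdots\otimes g_n)=f\otimes g_1\otimes\cdots\otimes g_n,$$ $$a(f)(g_1\otimes\cdots\otimes g_n)=\sum_{k=1}^n q^{k-1}\langle f,g_k\rangle\, g_1\otimes\cdots\otimes\hat g_k\otimes\cdots\otimes g_n,$$ $$p(f)(g_1\otimes\cdots\otimes g_n)=\sum_{k=1}^n q^{k-1}(fg_k)\otimes g_1\otimes\cdots\otimes\hat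 g_k\otimes\cdots\otimes g_n,$$ with $a^*(f)\Omega=f$ and $a(f)\Omega=p(f)\Omega=0$. The centered $q$-Poisson process is $X(t)=a^*(\mathbf 1_{[0,t)})+a(\mathbf 1_{[0,t)})+p(\mathbf 1_{[0,t)})$, $t\ge 0$. The vacuum state is $E[A]=\langle\Omega,A\Omega\rangle_q$, with $L^2$-norm $\|A\|_2=E[A^*A]^{1/2}=\|A\Omega\|$. For a subdivision $\mathcal I$ of $[0,t)$ given by $0=a_1<a_2<\cdots<a_{N+1}=t$, put $\delta(\mathcal I)=\max_i(a_{i+1}-a_i)$ and $$\psi_m(t;\mathcal I)=\sum_{\substack{u_1,\dots,u_m\in\{1,\dots,N\}\\ \text{pairwise distinct}}}\ \prod_{j=1}^m\bigl(X(a_{u_j+1})-X(a_{u_j})\bigr)$$ (ordered products). Let the polynomials $C_{q,m}(x,t)$ in $x$ (a scaled version of the centered continuous big $q$-Hermite polynomials) be defined by $C_{q,0}=1$ and $$x\,C_{q,m}(x,t)=C_{q,m+1}(x,t)+[m]_q\,C_{q,m}(x,t)+t\,[m]_q\,C_{q,m-1}(x,t),\qquad m\ge 0,$$ where $[m]_q=1+q+\cdots+q^{m-1}$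 and $[0]_q=0$ (so that the last term vanishes for $m=0$). Then for every $m\ge 0$ and $t\ge 0$ the full stochastic measure $\psi_m(t)=\lim_{\delta(\mathcal I)\to 0}\psi_m(t;\mathcal I)$ exists as a limit in the $L^2$-norm with respect to the vacuum state, and $$\psi_m(t)=C_{q,m}(X(t),t).$$ -/

import Mathlib

open MeasureTheory Filter Topology
open scoped TensorProduct DirectSum ENNReal

noncomputable section

namespace QFock

/-! ### The algebraic Fock space of a complex Hilbert space and its `q`-inner product -/

section Fock

variable (H : Type*) [NormedAddCommGroup H] [InnerProductSpace ℂ H]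

/-- The `n`-fold algebraic tensor power of `H`. -/
abbrev Tensor (n : ℕ) : Type _ := ⨂[ℂ] _ : Fin n, H

variable {H}

/-- The linear functional `g₁ ⊗ ⋯ ⊗ gₙ ↦ ∏ ⟨fᵢ, gᵢ⟩`. -/
def pureFunctional {n : ℕ} (f : Fin n → H) : Tensor H n →ₗ[ℂ] ℂ :=
  PiTensorProduct.lift
    ((MultilinearMap.mkPiAlgebra ℂ (Fin n) ℂ).compLinearMap fun i => (innerSL ℂ (f i)).toLinearMap)

/-- The conjugate-linear functional `f₁ ⊗ ⋯ ⊗ fₙ ↦ ∏ ⟨fᵢ, gᵢ⟩`. -/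
def pureConjFunctional {n : ℕ} (g : Fin n → H) : Tensor H n →ₗ⋆[ℂ] ℂ where
  toFun x := star (pureFunctional g x)
  map_add' x y := by simp
  map_smul' c x := by simp

theorem pureConjFunctional_tprod {n : ℕ} (f g : Fin n → H) :
    pureConjFunctional g (PiTensorProduct.tprod ℂ f) = ∏ i, inner ℂ (f i) (g i) := by
  simp [pureConjFunctional, pureFunctional]

theorem conjFunctional_ext {n : ℕ} {A B : Tensor H n →ₗ⋆[ℂ] ℂ}
    (h : ∀ f, A (PiTensorProduct.tprod ℂ f) = B (PiTensorProduct.tprod ℂ f)) : A = B := by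
  ext x
  induction x using PiTensorProduct.induction_on with
  | smul_tprod r f => simp [h]
  | add x y hx hy => simp [hx, hy]

/-- The sesquilinear form `⟨·, ·⟩₀` on the `n`-th tensor power, conjugate-linear in the first
argument: `⟨f₁ ⊗ ⋯ ⊗ fₙ, g₁ ⊗ ⋯ ⊗ gₙ⟩₀ = ∏ ⟨fᵢ, gᵢ⟩`. -/
def form0 (n : ℕ) : Tensor H n →ₗ⋆[ℂ] Tensor H n →ₗ[ℂ] ℂ :=
  LinearMap.flip (PiTensorProduct.lift
    { toFun := fun g => pureConjFunctional g
      map_update_add' := by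
        intro _ g i x y
        refine conjFunctional_ext fun f => ?_
        simp only [LinearMap.add_apply, pureConjFunctional_tprod]
        rw [← Finset.mul_prod_erase _ _ (Finset.mem_univ i),
          ← Finset.mul_prod_erase _ _ (Finset.mem_univ i),
          ← Finset.mul_prod_erase _ _ (Finset.mem_univ i)]
        simp only [Function.update_self, inner_add_right, add_mul]
        congr 2 <;> refine Finset.prod_congr rfl fun j hj => ?_ <;>
          simp [Function.update_of_ne (Finset.ne_of_mem_erase hj)]
      map_update_smul' := by
        intro _ g i c x
        refine conjFunctional_ext fun f => ?_
        simp only [LinearMap.smul_apply, pureConjFunctional_tprod]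
        rw [← Finset.mul_prod_erase _ _ (Finset.mem_univ i),
          ← Finset.mul_prod_erase _ _ (Finset.mem_univ i)]
        simp only [Function.update_self, inner_smul_right, smul_eq_mul, mul_assoc]
        congr 2
        refine Finset.prod_congr rfl fun j hj => ?_
        simp [Function.update_of_ne (Finset.ne_of_mem_erase hj)] })

theorem form0_tprod {n : ℕ} (f g : Fin n → H) :
    form0 n (PiTensorProduct.tprod ℂ f) (PiTensorProduct.tprod ℂ g) = ∏ i, inner ℂ (f i) (g i) := by
  simp [form0, pureConjFunctional_tprod]

/-- The number of inversions of a permutation. -/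
def inversions {n : ℕ} (σ : Equiv.Perm (Fin n)) : ℕ :=
  (Finset.univ.filter fun p : Fin n × Fin n => p.1 < p.2 ∧ σ p.2 < σ p.1).card

/-- The operator `P_q (f₁ ⊗ ⋯ ⊗ fₙ) = ∑_σ q^{i(σ)} f_{σ(1)} ⊗ ⋯ ⊗ f_{σ(n)}`. -/
def Pq (q : ℝ) (n : ℕ) : Tensor H n →ₗ[ℂ] Tensor H n :=
  ∑ σ : Equiv.Perm (Fin n), ((q ^ inversions σ : ℝ) : ℂ) •
    (PiTensorProduct.reindex ℂ (fun _ : Fin n => H) σ.symm).toLinearMap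

theorem Pq_tprod (q : ℝ) {n : ℕ} (f : Fin n → H) :
    Pq q n (PiTensorProduct.tprod ℂ f) = ∑ σ : Equiv.Perm (Fin n),
      ((q ^ inversions σ : ℝ) : ℂ) • PiTensorProduct.tprod ℂ fun i => f (σ i) := by
  simp [Pq, PiTensorProduct.reindex_tprod]

/-- The sesquilinear form `⟨·, ·⟩_q = ⟨·, P_q ·⟩₀` on the `n`-th tensor power. -/
def formq (q : ℝ) (n : ℕ) : Tensor H n →ₗ⋆[ℂ] Tensor H n →ₗ[ℂ] ℂ :=
  (form0 n).compl₂ (Pq q n)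

theorem formq_tprod (q : ℝ) {n : ℕ} (f g : Fin n → H) :
    formq q n (PiTensorProduct.tprod ℂ f) (PiTensorProduct.tprod ℂ g) =
      ∑ σ : Equiv.Perm (Fin n), ((q ^ inversions σ : ℝ) : ℂ) * ∏ i, inner ℂ (f i) (g (σ i)) := by
  simp [formq, Pq_tprod, form0_tprod]

/-! The form `⟨·, ·⟩_q` is Hermitian and positive. -/

theorem inversions_symm_trans {n : ℕ} (ρ τ : Equiv.Perm (Fin n)) :
    inversions (ρ.symm.trans τ) =
      (Finset.univ.filter fun p : Fin n × Fin n => p.1 < p.2 ∧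
        ¬ (ρ p.1 < ρ p.2 ↔ τ p.1 < τ p.2)).card := by
  unfold inversions
  refine Finset.card_bij' (fun p _ => if ρ.symm p.1 < ρ.symm p.2 then (ρ.symm p.1, ρ.symm p.2)
      else (ρ.symm p.2, ρ.symm p.1))
    (fun p _ => if ρ p.1 < ρ p.2 then (ρ p.1, ρ p.2) else (ρ p.2, ρ p.1)) ?_ ?_ ?_ ?_
  · rintro ⟨a, b⟩ h
    obtain ⟨h1, h2⟩ := (Finset.mem_filter.1 h).2
    simp only [Equiv.trans_apply] at h1 h2
    refine Finset.mem_filter.2 ⟨Finset.mem_univ _, ?_⟩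
    have hne : ρ.symm a ≠ ρ.symm b := fun h => h1.ne (ρ.symm.injective h)
    by_cases h3 : ρ.symm a < ρ.symm b
    · simp only [h3, if_true, Equiv.apply_symm_apply]
      exact ⟨trivial, fun h => absurd (h.1 h1) h2.not_gt⟩
    · simp only [h3, if_false, Equiv.apply_symm_apply]
      exact ⟨lt_of_le_of_ne (not_lt.1 h3) hne.symm, fun h => absurd (h.2 h2) h1.not_gt⟩
  · rintro ⟨a, b⟩ h
    obtain ⟨h1, h2⟩ := (Finset.mem_filter.1 h).2
    simp only at h1 h2
    refine Finset.mem_filter.2 ⟨Finset.mem_univ _, ?_⟩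
    have hr : ρ a ≠ ρ b := fun h => h1.ne (ρ.injective h)
    have ht : τ a ≠ τ b := fun h => h1.ne (τ.injective h)
    by_cases h3 : ρ a < ρ b
    · simp only [h3, if_true, Equiv.trans_apply, Equiv.symm_apply_apply]
      exact ⟨trivial, lt_of_le_of_ne (not_lt.1 fun h => h2 ⟨fun _ => h, fun _ => h3⟩) ht.symm⟩
    · simp only [h3, if_false, Equiv.trans_apply, Equiv.symm_apply_apply]
      refine ⟨lt_of_le_of_ne (not_lt.1 h3) hr.symm, ?_⟩
      by_contra h4
      exact h2 ⟨fun h => absurd h h3, fun h => absurd h h4⟩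
  · rintro ⟨a, b⟩ h
    have h1 := (Finset.mem_filter.1 h).2.1
    simp only at h1
    by_cases h3 : ρ.symm a < ρ.symm b <;> simp [h3, h1, h1.not_gt]
  · rintro ⟨a, b⟩ h
    have h1 := (Finset.mem_filter.1 h).2.1
    simp only at h1
    by_cases h3 : ρ a < ρ b <;> simp [h3, h1, h1.not_gt]

open scoped ComplexOrder Matrix in
theorem posSemidef_pair {ι : Type*} [Fintype ι] {q : ℝ} (h1 : -1 ≤ q) (h2 : q ≤ 1)
    (s : ι → Prop) [DecidablePred s] :
    (Matrix.of fun a b : ι => if (s a ↔ s b) then (1 : ℂ) else (q : ℂ)).PosSemidef := by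
  have e : (Matrix.of fun a b : ι => if (s a ↔ s b) then (1 : ℂ) else (q : ℂ)) =
      (((1 + q) / 2 : ℝ) : ℂ) • Matrix.vecMulVec (fun _ => 1) (star fun _ : ι => (1 : ℂ)) +
      (((1 - q) / 2 : ℝ) : ℂ) • Matrix.vecMulVec (fun a => if s a then (1 : ℂ) else -1)
        (star fun a => if s a then (1 : ℂ) else -1) := by
    ext a b
    by_cases ha : s a <;> by_cases hb : s b <;>
      simp [Matrix.vecMulVec_apply, ha, hb] <;> ring
  rw [e]
  refine ((Matrix.posSemidef_vecMulVec_self_star _).smul ?_).add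
    ((Matrix.posSemidef_vecMulVec_self_star _).smul ?_)
  · exact_mod_cast (by linarith : (0 : ℝ) ≤ (1 + q) / 2)
  · exact_mod_cast (by linarith : (0 : ℝ) ≤ (1 - q) / 2)

open scoped ComplexOrder Matrix in
theorem posSemidef_prod {ι κ : Type*} [Fintype ι] (s : Finset κ) (M : κ → Matrix ι ι ℂ)
    (h : ∀ k ∈ s, (M k).PosSemidef) :
    (Matrix.of fun a b : ι => ∏ k ∈ s, M k a b).PosSemidef := by
  classical
  induction s using Finset.induction_on with
  | empty =>
    have e : (Matrix.of fun a b : ι => ∏ k ∈ (∅ : Finset κ), M k a b) =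
        Matrix.vecMulVec (fun _ => 1) (star fun _ : ι => (1 : ℂ)) := by
      ext a b; simp [Matrix.vecMulVec_apply]
    rw [e]
    exact Matrix.posSemidef_vecMulVec_self_star _
  | insert k s hk ih =>
    have e : (Matrix.of fun a b : ι => ∏ k ∈ insert k s, M k a b) =
        M k ⊙ (Matrix.of fun a b : ι => ∏ k ∈ s, M k a b) := by
      ext a b; simp [Finset.prod_insert hk]
    rw [e]
    exact (h k (Finset.mem_insert_self _ _)).hadamard
      (ih fun j hj => h j (Finset.mem_insert_of_mem hj))

open scoped ComplexOrder Matrix in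
theorem posSemidef_inversions {ι : Type*} [Fintype ι] {q : ℝ} (h1 : -1 ≤ q) (h2 : q ≤ 1) {n : ℕ}
    (r : ι → Equiv.Perm (Fin n)) :
    (Matrix.of fun a b : ι =>
      ((q ^ inversions ((r a).symm.trans (r b)) : ℝ) : ℂ)).PosSemidef := by
  have e : (Matrix.of fun a b : ι => ((q ^ inversions ((r a).symm.trans (r b)) : ℝ) : ℂ)) =
      Matrix.of fun a b : ι => ∏ p ∈ Finset.univ.filter fun p : Fin n × Fin n => p.1 < p.2,
        (Matrix.of fun a b : ι =>
          if (r a p.1 < r a p.2 ↔ r b p.1 < r b p.2) then (1 : ℂ) else (q : ℂ)) a b := by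
    ext a b
    simp only [Matrix.of_apply, inversions_symm_trans]
    rw [Finset.prod_ite, Finset.prod_const_one, one_mul, Finset.prod_const, Finset.filter_filter]
    push_cast
    rfl
  rw [e]
  exact posSemidef_prod _ _ fun p _ => posSemidef_pair h1 h2 fun a => r a p.1 < r a p.2

theorem inversions_symm {n : ℕ} (σ : Equiv.Perm (Fin n)) : inversions σ.symm = inversions σ := by
  have h := inversions_symm_trans σ (Equiv.refl _)
  have h' := inversions_symm_trans (Equiv.refl _) σ
  have e1 : σ.symm.trans (Equiv.refl _) = σ.symm := rfl
  have e2 : (Equiv.refl (Fin n)).symm.trans σ = σ := rfl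
  rw [e1] at h
  rw [e2] at h'
  rw [h, h']
  congr 1
  ext p
  simp only [Finset.mem_filter]
  tauto

theorem exists_sum_tprod {n : ℕ} (x : Tensor H n) :
    ∃ (s : Finset (Fin n → H)) (c : (Fin n → H) → ℂ),
      x = ∑ f ∈ s, c f • PiTensorProduct.tprod ℂ f := by
  have hx : x ∈ Submodule.span ℂ (Set.range (PiTensorProduct.tprod ℂ (s := fun _ : Fin n => H))) := by
    rw [PiTensorProduct.span_tprod_eq_top]; trivial
  obtain ⟨c, rfl⟩ := Finsupp.mem_span_range_iff_exists_finsupp.1 hx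
  exact ⟨c.support, c, rfl⟩

theorem formq_sum_left (q : ℝ) {n : ℕ} (s : Finset (Fin n → H)) (c : (Fin n → H) → ℂ)
    (y : Tensor H n) :
    formq q n (∑ f ∈ s, c f • PiTensorProduct.tprod ℂ f) y =
      ∑ f ∈ s, star (c f) * formq q n (PiTensorProduct.tprod ℂ f) y := by
  rw [map_sum, LinearMap.sum_apply]
  refine Finset.sum_congr rfl fun f _ => ?_
  rw [map_smulₛₗ]
  rfl

theorem formq_sum_right (q : ℝ) {n : ℕ} (s : Finset (Fin n → H)) (c : (Fin n → H) → ℂ)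
    (x : Tensor H n) :
    formq q n x (∑ f ∈ s, c f • PiTensorProduct.tprod ℂ f) =
      ∑ f ∈ s, c f * formq q n x (PiTensorProduct.tprod ℂ f) := by
  rw [map_sum]
  refine Finset.sum_congr rfl fun f _ => ?_
  rw [map_smul]
  rfl

theorem formq_symm (q : ℝ) {n : ℕ} (x y : Tensor H n) :
    star (formq q n y x) = formq q n x y := by
  obtain ⟨s, c, rfl⟩ := exists_sum_tprod x
  obtain ⟨t, d, rfl⟩ := exists_sum_tprod y
  simp only [formq_sum_left, formq_sum_right, star_sum, star_mul', star_star, Finset.mul_sum]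
  rw [Finset.sum_comm]
  refine Finset.sum_congr rfl fun g _ => Finset.sum_congr rfl fun f _ => ?_
  have key : star (formq q n (PiTensorProduct.tprod ℂ g) (PiTensorProduct.tprod ℂ f)) =
      formq q n (PiTensorProduct.tprod ℂ f) (PiTensorProduct.tprod ℂ g) := by
    rw [formq_tprod, formq_tprod, star_sum, ← Equiv.sum_comp (Equiv.inv (Equiv.Perm (Fin n)))]
    refine Finset.sum_congr rfl fun σ _ => ?_
    have e : (Equiv.inv (Equiv.Perm (Fin n))) σ = σ.symm := rfl
    rw [e, inversions_symm, star_mul', star_prod, ← Equiv.prod_comp σ]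
    simp
  rw [key]
  ring

open scoped ComplexOrder Matrix in
theorem formq_nonneg {q : ℝ} (h1 : -1 ≤ q) (h2 : q ≤ 1) {n : ℕ} (x : Tensor H n) :
    0 ≤ formq q n x x := by
  obtain ⟨s, c, rfl⟩ := exists_sum_tprod x
  have hK := (posSemidef_inversions h1 h2 fun a : s × Equiv.Perm (Fin n) => a.2).hadamard
    (posSemidef_prod Finset.univ (fun i : Fin n => Matrix.gram ℂ
      fun a : s × Equiv.Perm (Fin n) => a.1.1 (a.2 i)) fun i _ => Matrix.posSemidef_gram ℂ _)
  have h := hK.dotProduct_mulVec_nonneg fun a => c a.1.1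
  have e : (star fun a : s × Equiv.Perm (Fin n) => c a.1.1) ⬝ᵥ
      (((Matrix.of fun a b : s × Equiv.Perm (Fin n) =>
          ((q ^ inversions (a.2.symm.trans b.2) : ℝ) : ℂ)) ⊙
        (Matrix.of fun a b => ∏ i : Fin n, Matrix.gram ℂ
          (fun a : s × Equiv.Perm (Fin n) => a.1.1 (a.2 i)) a b)) *ᵥ fun a => c a.1.1) =
      (Fintype.card (Equiv.Perm (Fin n)) : ℂ) *
        formq q n (∑ f ∈ s, c f • PiTensorProduct.tprod ℂ f)
          (∑ f ∈ s, c f • PiTensorProduct.tprod ℂ f) := by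
    have key (f g : Fin n → H) (ρ : Equiv.Perm (Fin n)) :
        ∑ τ : Equiv.Perm (Fin n), ((q ^ inversions (ρ.symm.trans τ) : ℝ) : ℂ) *
          ∏ i, inner ℂ (f (ρ i)) (g (τ i)) =
        formq q n (PiTensorProduct.tprod ℂ f) (PiTensorProduct.tprod ℂ g) := by
      rw [formq_tprod, ← Equiv.sum_comp (Equiv.mulRight ρ)]
      refine Finset.sum_congr rfl fun σ _ => ?_
      have e1 : ρ.symm.trans ((Equiv.mulRight ρ) σ) = σ := by ext; simp
      rw [e1, ← Equiv.prod_comp ρ fun i => inner ℂ (f i) (g (σ i))]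
      simp
    have L (f : Fin n → H) (ρ : Equiv.Perm (Fin n)) :
        ∑ g : s, ∑ τ : Equiv.Perm (Fin n), ((q ^ inversions (ρ.symm.trans τ) : ℝ) : ℂ) *
          (∏ i, inner ℂ (f (ρ i)) (g.1 (τ i))) * c g.1 =
        formq q n (PiTensorProduct.tprod ℂ f) (∑ g ∈ s, c g • PiTensorProduct.tprod ℂ g) := by
      rw [map_sum, ← Finset.sum_coe_sort s]
      refine Finset.sum_congr rfl fun g _ => ?_
      rw [← Finset.sum_mul, key, map_smul, smul_eq_mul, mul_comm]
    simp only [dotProduct, Matrix.mulVec, Matrix.hadamard_apply, Matrix.of_apply,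
      Matrix.gram_apply, Fintype.sum_prod_type, Pi.star_apply, L]
    simp only [Finset.sum_const, Finset.card_univ, nsmul_eq_mul]
    rw [← Finset.mul_sum]
    congr 1
    rw [Finset.sum_coe_sort s fun f => star (c f) *
      formq q n (PiTensorProduct.tprod ℂ f) (∑ g ∈ s, c g • PiTensorProduct.tprod ℂ g)]
    rw [formq_sum_left]
  rw [e] at h
  have hpos : (0 : ℂ) < (Fintype.card (Equiv.Perm (Fin n)) : ℂ) := by
    exact_mod_cast Fintype.card_pos
  exact le_of_mul_le_mul_left (by simpa using h) hpos

/-- The sesquilinear form `⟨·, ·⟩_q` on `⨁ₙ H^{⊗ n}`; components of different degrees are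
orthogonal. -/
def fockForm (q : ℝ) (x y : ⨁ n, Tensor H n) : ℂ :=
  DirectSum.toModule ℂ ℕ ℂ (fun n => formq q n (x n)) y

theorem fockForm_eq_sum (q : ℝ) (x y : ⨁ n, Tensor H n) (s : Finset ℕ)
    (hs : ∀ n ∉ s, y n = 0) : fockForm q x y = ∑ n ∈ s, formq q n (x n) (y n) := by
  classical
  conv_lhs => rw [← DirectSum.sum_support_of y]
  rw [fockForm, map_sum]
  have e (n : ℕ) : DirectSum.toModule ℂ ℕ ℂ (fun n => formq q n (x n))
      (DirectSum.of (fun n => Tensor H n) n (y n)) = formq q n (x n) (y n) :=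
    DirectSum.toModule_lof ℂ n (y n)
  simp only [e]
  refine Finset.sum_subset (fun n hn => ?_) fun n _ hn => ?_
  · by_contra h
    exact (DFinsupp.mem_support_iff.1 hn) (hs n h)
  · have : y n = 0 := by simpa using hn
    simp [this]

theorem exists_common_support (x y : ⨁ n, Tensor H n) :
    ∃ s : Finset ℕ, (∀ n ∉ s, x n = 0) ∧ ∀ n ∉ s, y n = 0 := by
  classical
  refine ⟨DFinsupp.support x ∪ DFinsupp.support y, fun n hn => ?_, fun n hn => ?_⟩ <;>
  · simp only [Finset.mem_union, DFinsupp.mem_support_iff, not_or, not_not] at hn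
    first | exact hn.1 | exact hn.2

theorem fockForm_symm (q : ℝ) (x y : ⨁ n, Tensor H n) :
    star (fockForm q y x) = fockForm q x y := by
  obtain ⟨s, hx, hy⟩ := exists_common_support x y
  rw [fockForm_eq_sum _ _ _ s hx, fockForm_eq_sum _ _ _ s hy, star_sum]
  exact Finset.sum_congr rfl fun n _ => formq_symm _ _ _

theorem fockForm_nonneg {q : ℝ} (h1 : -1 ≤ q) (h2 : q ≤ 1) (x : ⨁ n, Tensor H n) :
    0 ≤ (fockForm q x x).re := by
  obtain ⟨s, hx, _⟩ := exists_common_support x x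
  rw [fockForm_eq_sum _ _ _ s hx, Complex.re_sum]
  exact Finset.sum_nonneg fun n _ => (Complex.nonneg_iff.1 (formq_nonneg h1 h2 _)).1

theorem fockForm_add_left (q : ℝ) (x y z : ⨁ n, Tensor H n) :
    fockForm q (x + y) z = fockForm q x z + fockForm q y z := by
  obtain ⟨s, hz, _⟩ := exists_common_support z z
  rw [fockForm_eq_sum _ _ _ s hz, fockForm_eq_sum _ _ _ s hz, fockForm_eq_sum _ _ _ s hz,
    ← Finset.sum_add_distrib]
  refine Finset.sum_congr rfl fun n _ => ?_
  rw [DirectSum.add_apply, map_add, LinearMap.add_apply]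

theorem fockForm_smul_left (q : ℝ) (x y : ⨁ n, Tensor H n) (r : ℂ) :
    fockForm q (r • x) y = star r * fockForm q x y := by
  obtain ⟨s, hy, _⟩ := exists_common_support y y
  rw [fockForm_eq_sum _ _ _ s hy, fockForm_eq_sum _ _ _ s hy, Finset.mul_sum]
  refine Finset.sum_congr rfl fun n _ => ?_
  rw [DirectSum.smul_apply, map_smulₛₗ, LinearMap.smul_apply]
  rfl

/-- The algebraic Fock space `F_alg(H) = ⨁ₙ H^{⊗ n}`, equipped with `⟨·, ·⟩_q`, `-1 < q < 1`. -/
def AlgFock (_q : Set.Ioo (-1 : ℝ) 1) (H : Type*) [NormedAddCommGroup H] [InnerProductSpace ℂ H] :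
    Type _ :=
  ⨁ n, Tensor H n

instance (q : Set.Ioo (-1 : ℝ) 1) : AddCommGroup (AlgFock q H) :=
  inferInstanceAs (AddCommGroup (⨁ n, Tensor H n))

instance (q : Set.Ioo (-1 : ℝ) 1) : Module ℂ (AlgFock q H) :=
  inferInstanceAs (Module ℂ (⨁ n, Tensor H n))

/-- `⟨·, ·⟩_q` is a positive Hermitian form on the algebraic Fock space. -/
@[reducible]
def algFockCore (q : Set.Ioo (-1 : ℝ) 1) : PreInnerProductSpace.Core ℂ (AlgFock q H) where
  inner x y := fockForm (q : ℝ) x y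
  conj_inner_symm x y := fockForm_symm (H := H) q x y
  re_inner_nonneg x := fockForm_nonneg (H := H) q.2.1.le q.2.2.le x
  add_left x y z := fockForm_add_left (H := H) q x y z
  smul_left x y r := fockForm_smul_left (H := H) q x y r

instance (q : Set.Ioo (-1 : ℝ) 1) : SeminormedAddCommGroup (AlgFock q H) :=
  @InnerProductSpace.Core.toSeminormedAddCommGroup ℂ (AlgFock q H) _ _ _ (algFockCore q)

instance (q : Set.Ioo (-1 : ℝ) 1) : InnerProductSpace ℂ (AlgFock q H) :=
  InnerProductSpace.ofCore (algFockCore q)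

/-- The `q`-deformed full Fock space `F_q(H)`: the Hilbert space completion of `F_alg(H)` with
respect to `⟨·, ·⟩_q`. -/
abbrev FockSpace (q : Set.Ioo (-1 : ℝ) 1) (H : Type*) [NormedAddCommGroup H]
    [InnerProductSpace ℂ H] : Type _ :=
  UniformSpace.Completion (AlgFock q H)

/-- The inclusion of the `n`-th tensor power in the algebraic Fock space. -/
def incl (q : Set.Ioo (-1 : ℝ) 1) (n : ℕ) : Tensor H n →ₗ[ℂ] AlgFock q H :=
  DirectSum.lof ℂ ℕ (fun n => Tensor H n) n

/-- The pure tensor `f₁ ⊗ ⋯ ⊗ fₙ` as an element of the Fock space. -/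
def pureTensor (q : Set.Ioo (-1 : ℝ) 1) {n : ℕ} (f : Fin n → H) : AlgFock q H :=
  incl q n (PiTensorProduct.tprod ℂ f)

theorem inner_pureTensor (q : Set.Ioo (-1 : ℝ) 1) {n : ℕ} (f g : Fin n → H) :
    inner ℂ (pureTensor q f) (pureTensor q g) = ∑ σ : Equiv.Perm (Fin n),
      (((q : ℝ) ^ inversions σ : ℝ) : ℂ) * ∏ i, inner ℂ (f i) (g (σ i)) := by
  rw [← formq_tprod]
  refine (DirectSum.toModule_lof ℂ n _).trans ?_
  exact congrArg (fun w => formq (q : ℝ) n w (PiTensorProduct.tprod ℂ g))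
    (DirectSum.lof_apply (M := fun n => Tensor H n) ℂ n (PiTensorProduct.tprod ℂ f))

/-- The vacuum vector. -/
def vacuum (q : Set.Ioo (-1 : ℝ) 1) (H : Type*) [NormedAddCommGroup H] [InnerProductSpace ℂ H] :
    AlgFock q H :=
  pureTensor q (Fin.elim0 : Fin 0 → H)

/-! ### Creation, annihilation and preservation operators

These are operators on the Fock space with the common dense invariant domain `F_alg(H)`. -/

/-- A linear map on the algebraic Fock space given by its restrictions to the tensor powers. -/
def ofLevels (q : Set.Ioo (-1 : ℝ) 1) (F : ∀ n, Tensor H n →ₗ[ℂ] AlgFock q H) :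
    Module.End ℂ (AlgFock q H) :=
  DirectSum.toModule ℂ ℕ (AlgFock q H) F

theorem ofLevels_pureTensor (q : Set.Ioo (-1 : ℝ) 1) (F : ∀ n, Tensor H n →ₗ[ℂ] AlgFock q H) {n : ℕ}
    (g : Fin n → H) : ofLevels q F (pureTensor q g) = F n (PiTensorProduct.tprod ℂ g) :=
  DirectSum.toModule_lof ℂ n _

/-- The creation operator `a*(f)`. -/
def creation (q : Set.Ioo (-1 : ℝ) 1) (f : H) : Module.End ℂ (AlgFock q H) :=
  ofLevels q fun n => incl q (n + 1) ∘ₗ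
    PiTensorProduct.lift ((PiTensorProduct.tprod ℂ (s := fun _ : Fin (n + 1) => H)).curryLeft f)

/-- `a*(f) (g₁ ⊗ ⋯ ⊗ gₙ) = f ⊗ g₁ ⊗ ⋯ ⊗ gₙ`. -/
theorem creation_pureTensor (q : Set.Ioo (-1 : ℝ) 1) (f : H) {n : ℕ} (g : Fin n → H) :
    creation q f (pureTensor q g) = pureTensor q (Fin.cons f g : Fin (n + 1) → H) := by
  rw [creation, ofLevels_pureTensor, LinearMap.comp_apply, PiTensorProduct.lift.tprod]
  rfl

/-- The annihilation operator `a(f)`. -/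
def annihilation (q : Set.Ioo (-1 : ℝ) 1) (f : H) : Module.End ℂ (AlgFock q H) :=
  ofLevels q fun n => match n with
    | 0 => 0
    | n + 1 => ∑ k : Fin (n + 1), (((q : ℝ) ^ (k : ℕ) : ℝ) : ℂ) • incl q n ∘ₗ
        PiTensorProduct.lift (LinearMap.uncurryMid (M := fun _ : Fin (n + 1) => H) k
          ((innerSL ℂ f).toLinearMap.smulRight (PiTensorProduct.tprod ℂ)))

theorem annihilation_vacuum (q : Set.Ioo (-1 : ℝ) 1) (f : H) :
    annihilation q f (vacuum q H) = 0 := by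
  rw [annihilation, vacuum, ofLevels_pureTensor]
  rfl

/-- `a(f) (g₁ ⊗ ⋯ ⊗ gₙ) = ∑ₖ q^{k-1} ⟨f, gₖ⟩ g₁ ⊗ ⋯ ĝₖ ⋯ ⊗ gₙ`. -/
theorem annihilation_pureTensor (q : Set.Ioo (-1 : ℝ) 1) (f : H) {n : ℕ} (g : Fin (n + 1) → H) :
    annihilation q f (pureTensor q g) = ∑ k : Fin (n + 1),
      ((((q : ℝ) ^ (k : ℕ) : ℝ) : ℂ) * inner ℂ f (g k)) • pureTensor q (k.removeNth g) := by
  rw [annihilation, ofLevels_pureTensor, LinearMap.sum_apply]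
  refine Finset.sum_congr rfl fun k _ => ?_
  rw [LinearMap.smul_apply, LinearMap.comp_apply, PiTensorProduct.lift.tprod, mul_smul,
    LinearMap.uncurryMid_apply]
  exact congrArg _ (map_smul (incl q n) (inner ℂ f (g k)) (PiTensorProduct.tprod ℂ _))

/-- The preservation operator `p(T)` of an operator `T` on `H`. -/
def preservation (q : Set.Ioo (-1 : ℝ) 1) (T : H →ₗ[ℂ] H) : Module.End ℂ (AlgFock q H) :=
  ofLevels q fun n => match n with
    | 0 => 0
    | n + 1 => ∑ k : Fin (n + 1), (((q : ℝ) ^ (k : ℕ) : ℝ) : ℂ) • incl q (n + 1) ∘ₗ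
        PiTensorProduct.lift (LinearMap.uncurryMid (M := fun _ : Fin (n + 1) => H) k
          ((PiTensorProduct.tprod ℂ (s := fun _ : Fin (n + 1) => H)).curryLeft ∘ₗ T))

theorem preservation_vacuum (q : Set.Ioo (-1 : ℝ) 1) (T : H →ₗ[ℂ] H) :
    preservation q T (vacuum q H) = 0 := by
  rw [preservation, vacuum, ofLevels_pureTensor]
  rfl

/-- `p(T) (g₁ ⊗ ⋯ ⊗ gₙ) = ∑ₖ q^{k-1} (T gₖ) ⊗ g₁ ⊗ ⋯ ĝₖ ⋯ ⊗ gₙ`. -/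
theorem preservation_pureTensor (q : Set.Ioo (-1 : ℝ) 1) (T : H →ₗ[ℂ] H) {n : ℕ} (g : Fin (n + 1) → H) :
    preservation q T (pureTensor q g) = ∑ k : Fin (n + 1),
      (((q : ℝ) ^ (k : ℕ) : ℝ) : ℂ) • pureTensor q (Fin.cons (T (g k)) (k.removeNth g)) := by
  rw [preservation, ofLevels_pureTensor, LinearMap.sum_apply]
  refine Finset.sum_congr rfl fun k _ => ?_
  rw [LinearMap.smul_apply, LinearMap.comp_apply, PiTensorProduct.lift.tprod,
    LinearMap.uncurryMid_apply, pureTensor]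
  rfl

/-! ### The vacuum state and its `L²`-norm -/

/-- The vacuum state `E[A] = ⟨Ω, A Ω⟩`. -/
def vacuumState (q : Set.Ioo (-1 : ℝ) 1) (A : Module.End ℂ (AlgFock q H)) : ℂ :=
  inner ℂ (vacuum q H) (A (vacuum q H))

/-- The class of an operator `A` in `L²` of the vacuum state, realized as usual (GNS) by the vector
`A Ω` of the Hilbert space `F_q(H)`. -/
def toL2 {q : Set.Ioo (-1 : ℝ) 1} (A : Module.End ℂ (AlgFock q H)) : FockSpace q H :=
  ((A (vacuum q H) : AlgFock q H) : UniformSpace.Completion (AlgFock q H))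

/-- `E[B* A] = ⟨B Ω, A Ω⟩` in `L²`; in particular `‖A‖₂² = E[A* A] = ‖A Ω‖²`. -/
theorem vacuumState_mul {q : Set.Ioo (-1 : ℝ) 1} (A B B' : Module.End ℂ (AlgFock q H))
    (hB : ∀ x y, inner ℂ (B x) y = inner ℂ x (B' y)) :
    vacuumState q (B' * A) = inner ℂ (toL2 B) (toL2 A) := by
  simp [vacuumState, toL2, hB, UniformSpace.Completion.inner_coe]

end Fock

/-! ### The centered `q`-Poisson process -/

/-- The Hilbert space `L²(ℝ₊, dx)`. -/
abbrev L2Half : Type := Lp ℂ 2 (volume.restrict (Set.Ici (0 : ℝ)))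

theorem measure_Ico_ne_top (t : ℝ) :
    (volume.restrict (Set.Ici (0 : ℝ))) (Set.Ico 0 t) ≠ ∞ :=
  ne_top_of_le_ne_top (by simp) (Measure.restrict_apply_le _ _)

/-- The vector `1_{[0,t)}` of `L²(ℝ₊)`. -/
def indicatorVec (t : ℝ) : L2Half :=
  indicatorConstLp 2 measurableSet_Ico (measure_Ico_ne_top t) 1

/-- The operator of multiplication by `1_{[0,t)}` on `L²(ℝ₊)`. -/
def indicatorMul (t : ℝ) : L2Half →ₗ[ℂ] L2Half where
  toFun g := (indicatorConstLp ∞ measurableSet_Ico (measure_Ico_ne_top t) 1 :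
    Lp ℂ ∞ (volume.restrict (Set.Ici (0 : ℝ)))) • g
  map_add' _ _ := Lp.add_smul _ _ _
  map_smul' c _ := (Lp.smul_comm c _ _).symm

/-- The centered `q`-Poisson process `X(t) = a*(1_{[0,t)}) + a(1_{[0,t)}) + p(1_{[0,t)})`. -/
def qPoisson (q : Set.Ioo (-1 : ℝ) 1) (t : ℝ) : Module.End ℂ (AlgFock q L2Half) :=
  creation q (indicatorVec t) + annihilation q (indicatorVec t) + preservation q (indicatorMul t)

/-! ### Stochastic measures -/

/-- A subdivision `0 = a₀ < a₁ < ⋯ < a_N = t` of `[0, t)` into the intervals `[aᵢ, aᵢ₊₁)`. -/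
structure Subdivision (t : ℝ) where
  /-- the number of intervals -/
  N : ℕ
  /-- the endpoints -/
  a : Fin (N + 1) → ℝ
  strictMono : StrictMono a
  a_zero : a 0 = 0
  a_last : a (Fin.last N) = t

/-- The mesh `δ(I) = maxᵢ |Iᵢ|`. -/
def Subdivision.mesh {t : ℝ} (I : Subdivision t) : ℝ :=
  ⨆ i : Fin I.N, (I.a i.succ - I.a i.castSucc)

/-- The filter `δ(I) → 0` on the subdivisions of `[0, t)`. -/
def meshToZero (t : ℝ) : Filter (Subdivision t) :=
  Filter.comap Subdivision.mesh (𝓝 0)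

/-- There are subdivisions of arbitrarily small mesh, so limits as `δ(I) → 0` are unique. -/
theorem meshToZero_neBot {t : ℝ} (ht : 0 ≤ t) : (meshToZero t).NeBot := by
  refine Filter.comap_neBot_iff.2 fun s hs => ?_
  rcases ht.eq_or_lt with rfl | ht
  · refine ⟨⟨0, fun _ => 0, Subsingleton.strictMono (α := Fin 1) _, rfl, rfl⟩, ?_⟩
    have e : Subdivision.mesh (t := 0) ⟨0, fun _ => 0, Subsingleton.strictMono (α := Fin 1) _,
      rfl, rfl⟩ = 0 := by simp [Subdivision.mesh]
    rw [e]
    exact mem_of_mem_nhds hs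
  · have hlim : Tendsto (fun N : ℕ => t * (1 / ((N : ℝ) + 1))) atTop (𝓝 0) := by
      simpa using tendsto_one_div_add_atTop_nhds_zero_nat.const_mul t
    obtain ⟨N, hN⟩ := (hlim.eventually hs).exists
    have hp : (0 : ℝ) < (N : ℝ) + 1 := by positivity
    let I : Subdivision t :=
      { N := N + 1
        a := fun i => t * (i : ℕ) / ((N : ℝ) + 1)
        strictMono := fun i j h => by
          have h' : ((i : ℕ) : ℝ) < (j : ℕ) := by exact_mod_cast h
          dsimp only
          gcongr
        a_zero := by simp
        a_last := by simp [hp.ne'] }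
    refine ⟨I, ?_⟩
    have e : I.mesh = t * (1 / ((N : ℝ) + 1)) := by
      have e' (i : Fin (N + 1)) : I.a i.succ - I.a i.castSucc = t * (1 / ((N : ℝ) + 1)) := by
        simp only [I, Fin.val_succ, Fin.val_castSucc]
        push_cast
        field_simp
        ring
      exact (iSup_congr e').trans ciSup_const
    rw [e]
    exact hN

section StochasticMeasures

variable {R : Type*} [Ring R]

open scoped Classical in
/-- `St_π(t; I) = ∑_u ∏ᵢ (X(a_{u(i)+1}) - X(a_{u(i)}))`, the sum over all `u ∈ {1, …, N}ⁿ` with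
`u(i) = u(j) ↔ i ∼_π j` and the product taken in the order `i = 1, …, n`. Set partitions are
given by their equivalence relations. -/
def stochasticSum (X : ℝ → R) {n : ℕ} (π : Setoid (Fin n)) {t : ℝ} (I : Subdivision t) : R :=
  ∑ u : Fin n → Fin I.N with ∀ i j, u i = u j ↔ π i j,
    (List.ofFn fun i => X (I.a (u i).succ) - X (I.a (u i).castSucc)).prod

/-- The sums `ψ_n(t; I)` defining the full stochastic measure: the case of the partition `0̂` into
singletons, that is, of pairwise distinct `u(1), …, u(n)`. -/
def fullStochasticSum (X : ℝ → R) (n : ℕ) {t : ℝ} (I : Subdivision t) : R :=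
  stochasticSum X (⊥ : Setoid (Fin n)) I

end StochasticMeasures

/-- `ψ` is the `L²`-limit, with respect to the vacuum state, of `ψ_n(t; I)` as `δ(I) → 0`. -/
def IsFullStochasticMeasure {q : Set.Ioo (-1 : ℝ) 1} {H : Type*} [NormedAddCommGroup H]
    [InnerProductSpace ℂ H] (X : ℝ → Module.End ℂ (AlgFock q H)) (n : ℕ) (t : ℝ)
    (ψ : FockSpace q H) : Prop :=
  Tendsto (fun I : Subdivision t => toL2 (fullStochasticSum X n I)) (meshToZero t) (𝓝 ψ)

/-! ### The polynomials -/

/-- The `q`-integer `[n]_q = 1 + q + ⋯ + q^{n-1}`. -/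
def qInt (q : ℝ) (n : ℕ) : ℝ := ∑ j ∈ Finset.range n, q ^ j

open Polynomial in
/-- The centered continuous big `q`-Hermite polynomials `C_{q,m}(x, t)`, scaled to be the
`q`-analogs of the Charlier polynomials, as polynomials in `x`. -/
def bigQHermite (q t : ℝ) : ℕ → ℝ[X]
  | 0 => 1
  | 1 => X
  | m + 2 => X * bigQHermite q t (m + 1) - C (qInt q (m + 1)) * bigQHermite q t (m + 1) -
      C (t * qInt q (m + 1)) * bigQHermite q t m

open Polynomial in
/-- `x C_{q,m} = C_{q,m+1} + [m]_q C_{q,m} + t [m]_q C_{q,m-1}` (for `m = 0` the last term is `0`,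
since `[0]_q = 0`). -/
theorem bigQHermite_recursion (q t : ℝ) (m : ℕ) :
    X * bigQHermite q t m = bigQHermite q t (m + 1) + C (qInt q m) * bigQHermite q t m +
      C (t * qInt q m) * bigQHermite q t (m - 1) := by
  cases m with
  | zero => simp [bigQHermite, qInt]
  | succ m => simp only [bigQHermite, Nat.add_sub_cancel]; ring

end QFock

end

/-! The $L^2$-norm sees an operator $A$ only through $A\Omega$, so the claim compares vectors of the
Fock space. Write $f=\mathbf 1_{[0,t)}$; both sides are tied to the single vector $f^{\otimes m}$.

On the polynomial side, $X(t)f^{\otimes n}=f^{\otimes(n+1)}+[n]_q f^{\otimes n}+t[n]_q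
f^{\otimes(n-1)}$ is the recursion of $C_{q,n}$, hence $C_{q,m}(X(t),t)\Omega=f^{\otimes m}$ exactly
(`aeval_bigQHermite_vacuum`).

On the side of the sums, the annihilation and preservation parts of an increment vanish on tensors
built from the other cells of the subdivision. A product of increments over distinct cells therefore
sends $\Omega$ to the tensor of the cell indicators (`prod_increments_vacuum`). Expanding $f=\sum_i
e_i$ over the cells, $f^{\otimes m}$ is the same sum taken over all index tuples, so the error is
the sum over tuples with a repetition. The $e_i$ are orthogonal, so its squared norm is at most $m!$
times the total volume of these tuples (`norm_sq_sum_pureTensor_le`). That volume is at most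
$m^2\,\delta\,t^{m-1}$ (`sum_prod_not_injective_le`), which tends to $0$ with the mesh $\delta$. -/

namespace QFock

/-! ### Pure tensors in the Fock space: operator actions and a norm bound -/

section Fock

variable {H : Type*} [NormedAddCommGroup H] [InnerProductSpace ℂ H]

/-- `f₁, …, fₙ ↦ f₁ ⊗ ⋯ ⊗ fₙ` as a multilinear map into the Fock space. -/
def pureTensorMultilinear (q : Set.Ioo (-1 : ℝ) 1) (n : ℕ) :
    MultilinearMap ℂ (fun _ : Fin n => H) (AlgFock q H) :=
  (incl q n).compMultilinearMap (PiTensorProduct.tprod ℂ)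

theorem pureTensorMultilinear_apply (q : Set.Ioo (-1 : ℝ) 1) {n : ℕ} (f : Fin n → H) :
    pureTensorMultilinear q n f = pureTensor q f := rfl

theorem pureTensor_const_sum (q : Set.Ioo (-1 : ℝ) 1) (n : ℕ) {N : ℕ} (e : Fin N → H) :
    pureTensor q (fun _ : Fin n => ∑ i, e i) =
      ∑ u : Fin n → Fin N, pureTensor q fun j => e (u j) := by
  simp only [← pureTensorMultilinear_apply]
  exact (pureTensorMultilinear q n).map_sum fun _ i => e i

theorem creation_sub_pureTensor (q : Set.Ioo (-1 : ℝ) 1) (f f' : H) {n : ℕ} (g : Fin n → H) :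
    (creation q f - creation q f') (pureTensor q g) =
      pureTensor q (Fin.cons (f - f') g : Fin (n + 1) → H) := by
  rw [LinearMap.sub_apply, creation_pureTensor, creation_pureTensor]
  simp only [← pureTensorMultilinear_apply]
  exact (congrArg (fun L => L g)
    (map_sub (pureTensorMultilinear (H := H) q (n + 1)).curryLeft f f')).symm

/-- An increment of the process contains a difference of two annihilation operators. Comparing the
two factor by factor makes them cancel without using additivity in $f$; the next lemma does the same
for preservation. -/
theorem annihilation_pureTensor_congr (q : Set.Ioo (-1 : ℝ) 1) {f f' : H} {n : ℕ} (g : Fin n → H)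
    (h : ∀ k, inner ℂ f (g k) = inner ℂ f' (g k)) :
    annihilation q f (pureTensor q g) = annihilation q f' (pureTensor q g) := by
  cases n with
  | zero =>
    obtain rfl : g = Fin.elim0 := Subsingleton.elim _ _
    exact (annihilation_vacuum q f).trans (annihilation_vacuum q f').symm
  | succ n => simp only [annihilation_pureTensor, h]

theorem preservation_pureTensor_congr (q : Set.Ioo (-1 : ℝ) 1) {T T' : H →ₗ[ℂ] H} {n : ℕ}
    (g : Fin n → H) (h : ∀ k, T (g k) = T' (g k)) :
    preservation q T (pureTensor q g) = preservation q T' (pureTensor q g) := by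
  cases n with
  | zero =>
    obtain rfl : g = Fin.elim0 := Subsingleton.elim _ _
    exact (preservation_vacuum q T).trans (preservation_vacuum q T').symm
  | succ n => simp only [preservation_pureTensor, h]

/-- `a(f) f^{⊗(n+1)} = [n+1]_q ⟨f, f⟩ f^{⊗n}`. -/
theorem annihilation_pureTensor_const (q : Set.Ioo (-1 : ℝ) 1) (f : H) (n : ℕ) :
    annihilation q f (pureTensor q fun _ : Fin (n + 1) => f) =
      ((qInt q (n + 1) : ℂ) * inner ℂ f f) • pureTensor q fun _ : Fin n => f := by
  rw [annihilation_pureTensor, qInt, ← Fin.sum_univ_eq_sum_range, Complex.ofReal_sum,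
    Finset.sum_mul, Finset.sum_smul]
  -- Removing any factor from a constant family leaves the same constant family definitionally.
  rfl

/-- `p(T) f^{⊗n} = [n]_q f^{⊗n}` if `T f = f`. -/
theorem preservation_pureTensor_const (q : Set.Ioo (-1 : ℝ) 1) {T : H →ₗ[ℂ] H} {f : H}
    (hT : T f = f) (n : ℕ) :
    preservation q T (pureTensor q fun _ : Fin n => f) =
      (qInt q n : ℂ) • pureTensor q fun _ : Fin n => f := by
  cases n with
  | zero =>
    have e : (fun _ : Fin 0 => f) = Fin.elim0 := Subsingleton.elim _ _
    rw [e]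
    exact (preservation_vacuum q T).trans (by simp [qInt])
  | succ n =>
    rw [preservation_pureTensor, qInt, ← Fin.sum_univ_eq_sum_range, Complex.ofReal_sum,
      Finset.sum_smul]
    refine Finset.sum_congr rfl fun k _ => ?_
    congr 2
    ext j
    refine Fin.cases ?_ (fun j => ?_) j
    · simp [hT]
    · simp [Fin.removeNth]

/-- Expand the square into a sum over $u,v,\sigma$ and bound $|q^{i(\sigma)}|\le 1$. By
orthogonality, for given $u$ and $\sigma$ only $v=u\circ\sigma^{-1}$ can contribute, with value
$\prod_j w(u_j)$; the $n!$ choices of $\sigma$ give the constant. -/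
theorem norm_sq_sum_pureTensor_le (q : Set.Ioo (-1 : ℝ) 1) {N n : ℕ} (e : Fin N → H)
    (w : Fin N → ℝ) (hw : ∀ i, 0 ≤ w i)
    (he : ∀ i j, inner ℂ (e i) (e j) = if i = j then (w i : ℂ) else 0)
    (S : Finset (Fin n → Fin N)) :
    ‖∑ u ∈ S, pureTensor q fun j => e (u j)‖ ^ 2 ≤ n.factorial * ∑ u ∈ S, ∏ j, w (u j) := by
  have hnorm (i j : Fin N) : ‖(inner ℂ (e i) (e j) : ℂ)‖ = if i = j then w i else 0 := by
    rw [he]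
    split_ifs
    · simp [abs_of_nonneg (hw i)]
    · simp
  -- Enlarging `S` to all tuples allows the substitution $v\mapsto v\circ\sigma$, after which the
  -- sum of products factors over the coordinates.
  have hsum (u : Fin n → Fin N) (σ : Equiv.Perm (Fin n)) :
      ∑ v ∈ S, ∏ j, (if u j = v (σ j) then w (u j) else 0) ≤ ∏ j, w (u j) := by
    calc ∑ v ∈ S, ∏ j, (if u j = v (σ j) then w (u j) else 0)
        ≤ ∑ v : Fin n → Fin N, ∏ j, (if u j = v (σ j) then w (u j) else 0) := by
          refine Finset.sum_le_sum_of_subset_of_nonneg (Finset.subset_univ _) fun v _ _ =>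
            Finset.prod_nonneg fun j _ => ?_
          split_ifs
          exacts [hw _, le_rfl]
      _ = ∑ v : Fin n → Fin N, ∏ j, (if u j = v j then w (u j) else 0) :=
          (Equiv.arrowCongr σ.symm (Equiv.refl (Fin N))).sum_comp
            fun v : Fin n → Fin N => ∏ j, (if u j = v j then w (u j) else 0)
      _ = ∏ j, ∑ i, (if u j = i then w (u j) else 0) :=
          (Fintype.prod_sum fun j i => if u j = i then w (u j) else 0).symm
      _ = ∏ j, w (u j) := by simp
  have hpow (σ : Equiv.Perm (Fin n)) : ‖(((q : ℝ) ^ inversions σ : ℝ) : ℂ)‖ ≤ 1 := by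
    rw [Complex.norm_real, norm_pow]
    exact pow_le_one₀ (norm_nonneg _) (abs_le.2 ⟨q.2.1.le, q.2.2.le⟩)
  calc ‖∑ u ∈ S, pureTensor q fun j => e (u j)‖ ^ 2
      = ‖(inner ℂ (∑ u ∈ S, pureTensor q fun j => e (u j))
          (∑ u ∈ S, pureTensor q fun j => e (u j)) : ℂ)‖ := by
        rw [inner_self_eq_norm_sq_to_K]; simp
    _ = ‖∑ u ∈ S, ∑ v ∈ S, ∑ σ : Equiv.Perm (Fin n), (((q : ℝ) ^ inversions σ : ℝ) : ℂ) *
          ∏ j, inner ℂ (e (u j)) (e (v (σ j)))‖ := by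
        simp only [sum_inner, inner_sum, inner_pureTensor]
        rw [Finset.sum_comm]
    _ ≤ ∑ u ∈ S, ∑ v ∈ S, ∑ σ : Equiv.Perm (Fin n),
          ∏ j, (if u j = v (σ j) then w (u j) else 0) := by
        refine norm_sum_le_of_le _ fun u _ => norm_sum_le_of_le _ fun v _ =>
          norm_sum_le_of_le _ fun σ _ => ?_
        rw [norm_mul, norm_prod]
        simp only [hnorm]
        refine mul_le_of_le_one_left (Finset.prod_nonneg fun j _ => ?_) (hpow σ)
        split_ifs
        exacts [hw _, le_rfl]
    _ = ∑ u ∈ S, ∑ σ : Equiv.Perm (Fin n), ∑ v ∈ S,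
          ∏ j, (if u j = v (σ j) then w (u j) else 0) :=
        Finset.sum_congr rfl fun u _ => Finset.sum_comm
    _ ≤ ∑ u ∈ S, ∑ _σ : Equiv.Perm (Fin n), ∏ j, w (u j) :=
        Finset.sum_le_sum fun u _ => Finset.sum_le_sum fun σ _ => hsum u σ
    _ = n.factorial * ∑ u ∈ S, ∏ j, w (u j) := by
        simp [Finset.mul_sum, Fintype.card_perm]

end Fock

/-! ### Weights of index tuples with repetitions -/

/-- The total weight of the tuples with two given coordinates equal. -/
theorem sum_prod_filter_eq_le {N n : ℕ} (w : Fin N → ℝ) (hw : ∀ i, 0 ≤ w i) {δ : ℝ}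
    (hδ : ∀ i, w i ≤ δ) {i j : Fin (n + 1)} (hij : i ≠ j) :
    ∑ u : Fin (n + 1) → Fin N with u i = u j, ∏ k, w (u k) ≤ δ * (∑ x, w x) ^ n := by
  -- Split the tuple into its entry at `i` and the remaining free tuple `v`. The entry at `i` is
  -- forced to equal `v j` and costs at most `δ`; summing over `v` gives the power.
  obtain ⟨j, rfl⟩ := Fin.exists_succAbove_eq hij.symm
  rw [Finset.sum_filter, ← (Fin.insertNthEquiv (fun _ => Fin N) i).sum_comp,
    Fintype.sum_prod_type_right, Finset.sum_pow', Finset.mul_sum]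
  rw [Fintype.piFinset_univ]
  refine Finset.sum_le_sum fun v _ => ?_
  simp only [Fin.insertNthEquiv_apply, Fin.insertNth_apply_same, Fin.insertNth_apply_succAbove,
    Finset.sum_ite_eq', Finset.mem_univ, if_true, Fin.prod_univ_succAbove _ i]
  exact mul_le_mul_of_nonneg_right (hδ _) (Finset.prod_nonneg fun k _ => hw _)

/-- The total weight of the tuples with two equal coordinates. -/
theorem sum_prod_not_injective_le {N n : ℕ} (w : Fin N → ℝ) (hw : ∀ i, 0 ≤ w i) {δ : ℝ}
    (hδ : ∀ i, w i ≤ δ) (hδ0 : 0 ≤ δ) (S : Finset (Fin n → Fin N))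
    (hS : ∀ u ∈ S, ¬ Function.Injective u) :
    ∑ u ∈ S, ∏ k, w (u k) ≤ (n : ℝ) ^ 2 * (δ * (∑ x, w x) ^ (n - 1)) := by
  classical
  cases n with
  | zero =>
    -- The empty tuple is injective, so the truncated exponent `n - 1` is harmless here.
    have : S = ∅ := Finset.eq_empty_of_forall_notMem fun u hu =>
      hS u hu (Function.injective_of_subsingleton u)
    simp [this]
  | succ n =>
    have hp (u : Fin (n + 1) → Fin N) : 0 ≤ ∏ k, w (u k) := Finset.prod_nonneg fun k _ => hw _
    have hT : 0 ≤ δ * (∑ x, w x) ^ n :=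
      mul_nonneg hδ0 (pow_nonneg (Finset.sum_nonneg fun x _ => hw x) n)
    -- Union bound over the ordered pairs of positions that may coincide; counting the diagonal as
    -- well later gives the square in the bound.
    let P : Finset (Fin (n + 1) × Fin (n + 1)) := Finset.univ.filter fun p => p.1 ≠ p.2
    have hite (u : Fin (n + 1) → Fin N) (p : Fin (n + 1) × Fin (n + 1)) :
        0 ≤ if u p.1 = u p.2 then ∏ k, w (u k) else 0 := by
      split_ifs
      exacts [hp u, le_rfl]
    calc ∑ u ∈ S, ∏ k, w (u k)
        ≤ ∑ u ∈ S, ∑ p ∈ P, (if u p.1 = u p.2 then ∏ k, w (u k) else 0) := by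
          refine Finset.sum_le_sum fun u hu => ?_
          obtain ⟨i, j, h, hij⟩ := Function.not_injective_iff.1 (hS u hu)
          have hle := Finset.single_le_sum (s := P)
            (f := fun p => if u p.1 = u p.2 then ∏ k, w (u k) else 0)
            (fun p _ => hite u p) (a := (i, j)) (by simpa [P] using hij)
          rwa [if_pos h] at hle
      _ ≤ ∑ u : Fin (n + 1) → Fin N, ∑ p ∈ P, (if u p.1 = u p.2 then ∏ k, w (u k) else 0) :=
          Finset.sum_le_sum_of_subset_of_nonneg (Finset.subset_univ S) fun u _ _ =>
            Finset.sum_nonneg fun p _ => hite u p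
      _ = ∑ p ∈ P, ∑ u : Fin (n + 1) → Fin N with u p.1 = u p.2, ∏ k, w (u k) := by
          rw [Finset.sum_comm]
          simp only [Finset.sum_filter]
      _ ≤ ∑ p ∈ P, δ * (∑ x, w x) ^ n :=
          Finset.sum_le_sum fun p hp => sum_prod_filter_eq_le w hw hδ (Finset.mem_filter.1 hp).2
      _ ≤ ∑ _p : Fin (n + 1) × Fin (n + 1), δ * (∑ x, w x) ^ n :=
          Finset.sum_le_sum_of_subset_of_nonneg (Finset.subset_univ _) fun _ _ _ => hT
      _ = _ := by
          simp [sq]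

/-! ### Indicator vectors -/

/-- Since $[0,s)\cap[0,t)=[0,\min(s,t))$, inner products become minima, and so do multiplications in
the next lemma. All facts about cells then follow by linearity, with no further measure theory. -/
theorem inner_indicatorVec {s t : ℝ} (hs : 0 ≤ s) (ht : 0 ≤ t) :
    inner ℂ (indicatorVec s) (indicatorVec t) = ((min s t : ℝ) : ℂ) := by
  rw [indicatorVec, indicatorVec, L2.inner_indicatorConstLp_one_indicatorConstLp_one
    measurableSet_Ico measurableSet_Ico (measure_Ico_ne_top s) (measure_Ico_ne_top t)]
  have e : Set.Ico 0 s ∩ Set.Ico 0 t ∩ Set.Ici 0 = Set.Ico 0 (min s t) := by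
    ext x; simp only [Set.mem_inter_iff, Set.mem_Ico, Set.mem_Ici, lt_min_iff]; tauto
  rw [measureReal_restrict_apply (measurableSet_Ico.inter measurableSet_Ico), e]
  simp [Real.volume_real_Ico, hs, ht]

theorem indicatorMul_indicatorVec (s t : ℝ) :
    indicatorMul s (indicatorVec t) = indicatorVec (min s t) := by
  refine Lp.ext ?_
  refine (Lp.coeFn_lpSMul (r := 2) (indicatorConstLp ∞ measurableSet_Ico (measure_Ico_ne_top s)
    (1 : ℂ)) (indicatorVec t)).trans ?_
  filter_upwards [indicatorConstLp_coeFn (p := ∞) (hs := measurableSet_Ico)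
      (hμs := measure_Ico_ne_top s) (c := (1 : ℂ)),
    indicatorConstLp_coeFn (p := 2) (hs := measurableSet_Ico)
      (hμs := measure_Ico_ne_top t) (c := (1 : ℂ)),
    indicatorConstLp_coeFn (p := 2) (hs := measurableSet_Ico)
      (hμs := measure_Ico_ne_top (min s t)) (c := (1 : ℂ))] with x h1 h2 h3
  rw [indicatorVec, indicatorVec, h3, Pi.smul_apply', h1, h2]
  simp only [Set.indicator_apply, Set.mem_Ico, lt_min_iff]
  split_ifs <;> simp_all

theorem indicatorVec_zero : indicatorVec 0 = 0 := by
  have h := inner_indicatorVec le_rfl le_rfl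
  rw [min_self, Complex.ofReal_zero] at h
  exact inner_self_eq_zero.1 h

/-! ### Increments over the intervals of a subdivision -/

namespace Subdivision

variable {t : ℝ} (I : Subdivision t)

/-- The length of the `i`-th interval. -/
def length (i : Fin I.N) : ℝ := I.a i.succ - I.a i.castSucc

/-- The indicator `1_{[aᵢ, aᵢ₊₁)}`. -/
noncomputable def vec (i : Fin I.N) : L2Half := indicatorVec (I.a i.succ) - indicatorVec (I.a i.castSucc)

theorem nonneg (i : Fin (I.N + 1)) : 0 ≤ I.a i :=
  I.a_zero ▸ I.strictMono.monotone (Fin.zero_le i)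

theorem castSucc_le_succ (i : Fin I.N) : I.a i.castSucc ≤ I.a i.succ :=
  I.strictMono.monotone (Fin.castSucc_le_succ i)

theorem length_nonneg (i : Fin I.N) : 0 ≤ I.length i := sub_nonneg.2 (I.castSucc_le_succ i)

theorem length_le_mesh (i : Fin I.N) : I.length i ≤ I.mesh :=
  le_ciSup (Set.finite_range fun i : Fin I.N => I.a i.succ - I.a i.castSucc).bddAbove i

theorem mesh_nonneg : 0 ≤ I.mesh := Real.iSup_nonneg I.length_nonneg

/-- Telescoping: split the sum of `F` over all endpoints once at the first and once at the last. It
serves for both lengths and indicators. -/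
theorem sum_sub {G : Type*} [AddCommGroup G] (F : ℝ → G) :
    ∑ i : Fin I.N, (F (I.a i.succ) - F (I.a i.castSucc)) = F t - F 0 := by
  rw [Finset.sum_sub_distrib]
  have h1 := Fin.sum_univ_succ fun i => F (I.a i)
  have h2 := Fin.sum_univ_castSucc fun i => F (I.a i)
  rw [I.a_zero] at h1
  rw [I.a_last] at h2
  rw [sub_eq_sub_iff_add_eq_add, add_comm, ← h1, h2, add_comm]

theorem sum_length : ∑ i, I.length i = t := (I.sum_sub fun x => x).trans (sub_zero t)

theorem sum_vec : ∑ i, I.vec i = indicatorVec t :=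
  (I.sum_sub indicatorVec).trans (by rw [indicatorVec_zero, sub_zero])

theorem le_or_le_of_ne {i j : Fin I.N} (h : i ≠ j) :
    I.a i.succ ≤ I.a j.castSucc ∨ I.a j.succ ≤ I.a i.castSucc :=
  -- `i < j` unfolds to `i.succ ≤ j.castSucc`, so it is passed directly to monotonicity.
  (lt_or_gt_of_ne h).imp (fun h => I.strictMono.monotone h) fun h => I.strictMono.monotone h

/-- Cell `j` lies wholly before or wholly after cell `i`, so the initial segments ending at the two
endpoints of cell `i` both contain cell `j` or both miss it. The same reason gives
`indicatorMul_vec_of_ne`. -/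
theorem inner_indicatorVec_vec_of_ne {i j : Fin I.N} (h : i ≠ j) :
    inner ℂ (indicatorVec (I.a i.succ)) (I.vec j) =
      inner ℂ (indicatorVec (I.a i.castSucc)) (I.vec j) := by
  have hi := I.castSucc_le_succ i
  have hj := I.castSucc_le_succ j
  simp only [vec, inner_sub_right, inner_indicatorVec (I.nonneg _) (I.nonneg _)]
  rcases I.le_or_le_of_ne h with h | h
  · rw [min_eq_left (h.trans hj), min_eq_left h, min_eq_left (hi.trans (h.trans hj)),
      min_eq_left (hi.trans h), sub_self, sub_self]
  · rw [min_eq_right (h.trans hi), min_eq_right (hj.trans (h.trans hi)), min_eq_right h,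
      min_eq_right (hj.trans h)]

theorem indicatorMul_vec_of_ne {i j : Fin I.N} (h : i ≠ j) :
    indicatorMul (I.a i.succ) (I.vec j) = indicatorMul (I.a i.castSucc) (I.vec j) := by
  have hi := I.castSucc_le_succ i
  have hj := I.castSucc_le_succ j
  simp only [vec, map_sub, indicatorMul_indicatorVec]
  rcases I.le_or_le_of_ne h with h | h
  · rw [min_eq_left (h.trans hj), min_eq_left h, min_eq_left (hi.trans (h.trans hj)),
      min_eq_left (hi.trans h), sub_self, sub_self]
  · rw [min_eq_right (h.trans hi), min_eq_right (hj.trans (h.trans hi)), min_eq_right h,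
      min_eq_right (hj.trans h)]

theorem inner_vec (i j : Fin I.N) :
    inner ℂ (I.vec i) (I.vec j) = if i = j then (I.length i : ℂ) else 0 := by
  split_ifs with h
  · subst h
    have hi := I.castSucc_le_succ i
    simp only [vec, inner_sub_left, inner_sub_right, inner_indicatorVec (I.nonneg _) (I.nonneg _),
      min_self, min_eq_left hi, min_eq_right hi, length]
    push_cast
    ring
  -- Only the left vector is opened, so that the two prefix inner products cancel.
  · nth_rw 1 [vec]
    rw [inner_sub_left, I.inner_indicatorVec_vec_of_ne h, sub_self]

/-- The increment of the process over an interval acts as creation on tensors of indicators of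
other intervals. -/
theorem increment_pureTensor (q : Set.Ioo (-1 : ℝ) 1) (i : Fin I.N) {n : ℕ} (u : Fin n → Fin I.N)
    (hu : ∀ k, i ≠ u k) :
    (qPoisson q (I.a i.succ) - qPoisson q (I.a i.castSucc)) (pureTensor q fun k => I.vec (u k)) =
      pureTensor q (Fin.cons (I.vec i) fun k => I.vec (u k) : Fin (n + 1) → L2Half) := by
  have h := creation_sub_pureTensor q (indicatorVec (I.a i.succ)) (indicatorVec (I.a i.castSucc))
    fun k => I.vec (u k)
  rw [LinearMap.sub_apply] at h
  simp only [qPoisson, LinearMap.sub_apply, LinearMap.add_apply]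
  rw [annihilation_pureTensor_congr q _ fun k => I.inner_indicatorVec_vec_of_ne (hu k),
    preservation_pureTensor_congr q _ fun k => I.indicatorMul_vec_of_ne (hu k),
    add_sub_add_right_eq_sub, add_sub_add_right_eq_sub]
  exact h

/-- The rightmost factor acts first. By injectivity each increment meets only indicators of other
cells, so it merely prepends its own. -/
theorem prod_increments_vacuum (q : Set.Ioo (-1 : ℝ) 1) {n : ℕ} (u : Fin n → Fin I.N)
    (hu : Function.Injective u) :
    (List.ofFn fun k => qPoisson q (I.a (u k).succ) - qPoisson q (I.a (u k).castSucc)).prod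
      (vacuum q L2Half) = pureTensor q fun k => I.vec (u k) := by
  induction n with
  | zero =>
    have e : (fun k => I.vec (u k)) = Fin.elim0 := Subsingleton.elim _ _
    rw [e]
    simp [vacuum]
  | succ n ih =>
    rw [List.ofFn_succ, List.prod_cons, Module.End.mul_apply,
      ih (fun k => u k.succ) fun a b h => Fin.succ_injective n (hu h),
      I.increment_pureTensor q (u 0) (fun k => u k.succ) fun k h =>
        (Fin.succ_ne_zero k) (hu h).symm]
    congr 1
    exact Fin.cons_self_tail fun k => I.vec (u k)

open scoped Classical in
theorem fullStochasticSum_vacuum (q : Set.Ioo (-1 : ℝ) 1) (n : ℕ) :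
    fullStochasticSum (qPoisson q) n I (vacuum q L2Half) =
      ∑ u : Fin n → Fin I.N with Function.Injective u, pureTensor q fun k => I.vec (u k) := by
  rw [fullStochasticSum, stochasticSum, LinearMap.sum_apply]
  have e (u : Fin n → Fin I.N) :
      (∀ i j, u i = u j ↔ (⊥ : Setoid (Fin n)) i j) ↔ Function.Injective u := by
    simp only [Setoid.bot_def]
    exact ⟨fun h i j => (h i j).1, fun h i j => h.eq_iff⟩
  refine Finset.sum_congr (Finset.filter_congr fun u _ => e u) fun u hu => ?_
  exact I.prod_increments_vacuum q u (Finset.mem_filter.1 hu).2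

/-- Up to sign the difference is the sum over non-injective tuples. For `n = 0` the factor $n^2$
makes the bound zero. -/
theorem norm_sq_fullStochasticSum_sub_le (q : Set.Ioo (-1 : ℝ) 1) (n : ℕ) :
    ‖fullStochasticSum (qPoisson q) n I (vacuum q L2Half) -
        pureTensor q fun _ : Fin n => indicatorVec t‖ ^ 2 ≤
      n.factorial * ((n : ℝ) ^ 2 * (I.mesh * t ^ (n - 1))) := by
  classical
  rw [I.fullStochasticSum_vacuum, ← I.sum_vec, pureTensor_const_sum, norm_sub_rev,
    ← Finset.sum_filter_add_sum_filter_not Finset.univ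
      (fun u : Fin n → Fin I.N => Function.Injective u), add_sub_cancel_left]
  refine (norm_sq_sum_pureTensor_le q I.vec I.length I.length_nonneg I.inner_vec _).trans ?_
  gcongr
  have h := sum_prod_not_injective_le I.length I.length_nonneg I.length_le_mesh I.mesh_nonneg
    (Finset.univ.filter fun u : Fin n → Fin I.N => ¬ Function.Injective u)
    fun u hu => (Finset.mem_filter.1 hu).2
  rwa [I.sum_length] at h

end Subdivision

/-! ### The polynomials of the process -/

/-- Creation raises the degree, annihilation lowers it with $\langle f,f\rangle=t$, and preservation
acts as a scalar because multiplication by $\mathbf 1_{[0,t)}$ fixes $f=\mathbf 1_{[0,t)}$. -/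
theorem qPoisson_pureTensor_const (q : Set.Ioo (-1 : ℝ) 1) {t : ℝ} (ht : 0 ≤ t) (n : ℕ) :
    qPoisson q t (pureTensor q fun _ : Fin (n + 1) => indicatorVec t) =
      (pureTensor q fun _ : Fin (n + 2) => indicatorVec t) +
        ((t * qInt q (n + 1) : ℝ) : ℂ) • (pureTensor q fun _ : Fin n => indicatorVec t) +
        (qInt q (n + 1) : ℂ) • pureTensor q fun _ : Fin (n + 1) => indicatorVec t := by
  rw [qPoisson, LinearMap.add_apply, LinearMap.add_apply, creation_pureTensor,
    annihilation_pureTensor_const, preservation_pureTensor_const, inner_indicatorVec ht ht,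
    min_self, Complex.ofReal_mul, mul_comm (t : ℂ)]
  · congr 3
    exact Fin.cons_self_tail fun _ : Fin (n + 2) => indicatorVec t
  · rw [indicatorMul_indicatorVec, min_self]

/-- `C_{q,n}(X(t), t) Ω = 1_{[0,t)}^{⊗n}`. -/
theorem aeval_bigQHermite_vacuum (q : Set.Ioo (-1 : ℝ) 1) {t : ℝ} (ht : 0 ≤ t) (n : ℕ) :
    Polynomial.aeval (qPoisson q t) ((bigQHermite q t n).map (algebraMap ℝ ℂ))
      (vacuum q L2Half) = pureTensor q fun _ : Fin n => indicatorVec t := by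
  induction n using Nat.twoStepInduction with
  | zero =>
    have e : (fun _ : Fin 0 => indicatorVec t) = Fin.elim0 := Subsingleton.elim _ _
    rw [e]
    simp [bigQHermite, vacuum]
  | one =>
    simp only [bigQHermite, Polynomial.map_X, Polynomial.aeval_X, qPoisson, LinearMap.add_apply,
      annihilation_vacuum, preservation_vacuum, add_zero]
    rw [vacuum, creation_pureTensor]
    congr 1
    ext j
    rw [Subsingleton.elim (α := Fin 1) j 0]
    rfl
  -- The two lower-order terms subtracted in the recursion are exactly the annihilation and
  -- preservation contributions, leaving the top tensor.
  | more n ih ih' =>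
    simp only [bigQHermite, Polynomial.map_sub, Polynomial.map_mul, Polynomial.map_X,
      Polynomial.map_C, map_sub, map_mul, Polynomial.aeval_X, Polynomial.aeval_C,
      LinearMap.sub_apply, Module.End.mul_apply, ih, ih', Module.algebraMap_end_apply,
      qPoisson_pureTensor_const q ht, Complex.coe_algebraMap, smul_smul, ← Complex.ofReal_mul]
    abel

end QFock

/-- For the centered `q`-Poisson process, `-1 < q < 1`, the full stochastic measures `ψ_m(t)` exist
as `L²`-limits with respect to the vacuum state and `ψ_m(t) = C_{q,m}(X(t), t)`. -/
theorem proposition5p5 (q : Set.Ioo (-1 : ℝ) 1) (m : ℕ) (t : ℝ) (ht : 0 ≤ t) :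
    QFock.IsFullStochasticMeasure (QFock.qPoisson q) m t
      (QFock.toL2 (Polynomial.aeval (QFock.qPoisson q t)
        ((QFock.bigQHermite q t m).map (algebraMap ℝ ℂ)))) := by
  have hsq : Tendsto (fun I : QFock.Subdivision t =>
      ‖QFock.fullStochasticSum (QFock.qPoisson q) m I (QFock.vacuum q QFock.L2Half) -
        QFock.pureTensor q fun _ : Fin m => QFock.indicatorVec t‖ ^ 2)
      (QFock.meshToZero t) (𝓝 0) := by
    have hlim : Tendsto (fun I : QFock.Subdivision t =>
        (m.factorial : ℝ) * ((m : ℝ) ^ 2 * (I.mesh * t ^ (m - 1)))) (QFock.meshToZero t) (𝓝 0) := by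
      have h : Tendsto (QFock.Subdivision.mesh (t := t)) (QFock.meshToZero t) (𝓝 0) :=
        tendsto_comap
      simpa using ((h.mul_const (t ^ (m - 1))).const_mul ((m : ℝ) ^ 2)).const_mul
        (m.factorial : ℝ)
    exact squeeze_zero (fun I => sq_nonneg _) (fun I => I.norm_sq_fullStochasticSum_sub_le q m) hlim
  rw [QFock.IsFullStochasticMeasure, tendsto_iff_norm_sub_tendsto_zero]
  -- Both vectors come from the algebraic Fock space, so the distance in the completion is the
  -- seminorm controlled by `hsq`.
  simp only [QFock.toL2, QFock.aeval_bigQHermite_vacuum q ht, ← UniformSpace.Completion.coe_sub,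
    UniformSpace.Completion.norm_coe]
  simpa using hsq.sqrt
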